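/- Let $m,n,d$ be nonnegative integers with $m>d+1$. Let $A\in\mathbb{R}^{n\times d}$ have full column rank, let $b\in\mathbb{R}^n$, put $f(x):=\|Ax-b\|_2^2$, and let $x^*=\arg\min_{x\in\mathbb{R}^d} f(x)$. Let $S\in\mathbb{R}^{m\times n}$ be a Gaussian sketch, i.e. a random matrix whose entries are i.i.d. $\mathcal{N}(0,1/m)$ (so that $\mathbb{E}[S^TS]=I_n$). Let $\hat{x}$ be the sketched least-squares estimator, i.e. almost surely $\hat{x}\in\arg\min_{x\in\mathbb{R}^d}\|SAx-Sb\|_2^2$. Then $\|A(\hat{x}-x^*)\|_2^2$ and $f(\hat{x})$ are integrable, and $$\mathbb{E}\big[\|A(\hat{x}-x^*)\|_2^2\big]=\mathbb{E}[f(\hat{x})]-f(x^*)=f(x^*)\,\frac{d}{m-d-1}.$$ -/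

import Mathlib

open MeasureTheory ProbabilityTheory
open scoped NNReal

noncomputable section

/-- The least-squares objective `x ↦ ‖A x - b‖₂²` (Euclidean norm). -/
def lsCost {n d : ℕ} (A : Matrix (Fin n) (Fin d) ℝ) (b : EuclideanSpace ℝ (Fin n))
    (x : EuclideanSpace ℝ (Fin d)) : ℝ :=
  ‖Matrix.toEuclideanLin A x - b‖ ^ 2

/-- `x` is a global minimizer of the least-squares objective of `(A, b)`. -/
def IsLeastSquaresSolution {n d : ℕ} (A : Matrix (Fin n) (Fin d) ℝ)
    (b : EuclideanSpace ℝ (Fin n)) (x : EuclideanSpace ℝ (Fin d)) : Prop :=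
  ∀ y : EuclideanSpace ℝ (Fin d), lsCost A b x ≤ lsCost A b y

/-- A Gaussian sketch: a random `m × n` matrix with i.i.d. entries of law `N(0, 1/m)`.
The variance `1/m` is the scaling for which `𝔼[Sᵀ S] = Iₙ`. -/
structure IsGaussianSketch {Ω : Type*} [MeasurableSpace Ω] (P : Measure Ω) {m n : ℕ}
    (S : Ω → Matrix (Fin m) (Fin n) ℝ) : Prop where
  hasLaw : ∀ i j, HasLaw (fun ω => S ω i j) (gaussianReal 0 ((m : ℝ≥0)⁻¹)) P
  indep : iIndepFun (fun (p : Fin m × Fin n) (ω : Ω) => S ω p.1 p.2) P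

end

/-!
Write `r = b - A x*`, which is orthogonal to the column space of `A`, let `u₁, …, u_d` be an
orthonormal basis of that column space, and put `G k = √m • S uₖ`, `g = √m • S r`. The normal
equations of the sketched problem say that the coordinates `y` of `A (x̂ - x*)` along `u` satisfy
`gram G *ᵥ y = (⟪G k, g⟫)ₖ`, so that `‖A (x̂ - x*)‖²` is the squared length of the coefficients of
the regression of `g` on the family `G` (`normSq_sketched_error`).

Since `r, u₁, …, u_d` are orthogonal, `G` is a family of independent standard Gaussian vectors of
`ℝᵐ`, and `g` is `‖r‖` times another one, independent of `G`
(`IsGaussianSketch.hasLaw_orthonormal`).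
Almost surely `G` is linearly independent (`ae_linearIndependent_pi_stdGaussian`). Averaging over
`g` alone turns the squared length into `‖r‖²` times the trace of `(gram G)⁻¹`
(`lintegral_normSq_inv_gram_mulVec`).

The `j`-th diagonal entry of `(gram G)⁻¹` is `1 / ‖h‖²`, where `h` is the projection of `G j` onto
the orthogonal complement of the span of the other vectors (`inv_gram_apply_self`). Given those
vectors, `h` is a standard Gaussian vector of a space of dimension `k = m - d + 1`, and the mean of
`1 / ‖h‖²` is `1 / (k - 2) = 1 / (m - d - 1)` (`lintegral_inv_normSq_stdGaussian`). Summing over `j`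
gives the mean squared error `‖r‖² d / (m - d - 1)`, and Pythagoras identifies it with the mean
excess cost (`IsLeastSquaresSolution.lsCost_eq_add`).

Means of nonnegative functions are computed as Lebesgue integrals with values in `[0, ∞]`, so that
integrability is a consequence of the computation.
-/

open scoped ENNReal Matrix RealInnerProductSpace

/-! ### Standard Gaussian vectors -/

section StdGaussian

variable {E : Type*} [NormedAddCommGroup E] [InnerProductSpace ℝ E] [FiniteDimensional ℝ E]
  [MeasurableSpace E] [BorelSpace E]

lemma integral_exp_neg_mul_sq_gaussianReal {s : ℝ} (hs : 0 ≤ s) :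
    ∫ x, Real.exp (-(s * x ^ 2 / 2)) ∂gaussianReal 0 1 = (1 + s) ^ (-(1 / 2) : ℝ) := by
  have h1 : (0 : ℝ) < 1 + s := by linarith
  rw [integral_gaussianReal_eq_integral_smul one_ne_zero]
  have (x : ℝ) : gaussianPDFReal 0 1 x • Real.exp (-(s * x ^ 2 / 2))
      = (√(2 * Real.pi))⁻¹ * Real.exp (-((1 + s) / 2) * x ^ 2) := by
    simp only [gaussianPDFReal, NNReal.coe_one, mul_one, sub_zero, smul_eq_mul, mul_assoc,
      ← Real.exp_add]
    ring_nf
  simp_rw [this]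
  rw [integral_const_mul, integral_gaussian, Real.rpow_neg h1.le, ← Real.sqrt_eq_rpow,
    ← Real.sqrt_inv, ← Real.sqrt_mul (by positivity), ← Real.sqrt_inv]
  congr 1
  field_simp

lemma integral_exp_neg_mul_normSq_stdGaussian {s : ℝ} (hs : 0 ≤ s) :
    ∫ x, Real.exp (-(s * ‖x‖ ^ 2 / 2)) ∂stdGaussian E
      = (1 + s) ^ (-(Module.finrank ℝ E / 2) : ℝ) := by
  rw [stdGaussian_eq_map_pi_orthonormalBasis (stdOrthonormalBasis ℝ E),
    integral_map (Measurable.aemeasurable (by fun_prop))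
      (Continuous.aestronglyMeasurable (by fun_prop))]
  have (x : Fin (Module.finrank ℝ E) → ℝ) :
      Real.exp (-(s * ‖∑ i, x i • stdOrthonormalBasis ℝ E i‖ ^ 2 / 2))
        = ∏ i, Real.exp (-(s * x i ^ 2 / 2)) := by
    rw [← Real.exp_sum, ← (stdOrthonormalBasis ℝ E).sum_sq_inner_right, Finset.mul_sum,
      Finset.sum_div, ← Finset.sum_neg_distrib]
    simp [inner_sum, inner_smul_right, orthonormal_iff_ite.1 (stdOrthonormalBasis ℝ E).orthonormal]
  simp_rw [this]
  rw [integral_fintype_prod_eq_prod (f := fun _ x ↦ Real.exp (-(s * x ^ 2 / 2)))]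
  simp only [integral_exp_neg_mul_sq_gaussianReal hs, Finset.prod_const, Finset.card_univ,
    Fintype.card_fin]
  rw [← Real.rpow_natCast, ← Real.rpow_mul (by linarith)]
  congr 1
  ring

lemma lintegral_exp_neg_mul_Ioi {a : ℝ} (ha : 0 < a) :
    ∫⁻ s in Set.Ioi (0 : ℝ), ENNReal.ofReal (Real.exp (-(s * a / 2)) / 2)
      = ENNReal.ofReal (a⁻¹) := by
  have hfun (s : ℝ) : Real.exp (-(s * a / 2)) / 2 = Real.exp (-(a / 2) * s) / 2 := by ring_nf
  simp_rw [hfun]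
  rw [← ofReal_integral_eq_lintegral_ofReal, integral_div,
    integral_exp_mul_Ioi (by linarith)]
  · congr 1
    simp
    field_simp
  · exact (integrableOn_exp_mul_Ioi (by linarith) 0).div_const 2
  · exact Filter.Eventually.of_forall fun s ↦ by positivity

lemma lintegral_one_add_rpow_Ioi {p : ℝ} (hp : 1 < p) :
    ∫⁻ s in Set.Ioi (0 : ℝ), ENNReal.ofReal ((1 + s) ^ (-p) / 2)
      = ENNReal.ofReal ((2 * p - 2)⁻¹) := by
  have hpre : (MeasurableEquiv.addLeft (1 : ℝ)) ⁻¹' Set.Ioi 1 = Set.Ioi 0 := by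
    ext s; simp
  have hshift := (measurePreserving_add_left volume (1 : ℝ)).setLIntegral_comp_preimage_emb
    (MeasurableEquiv.addLeft (1 : ℝ)).measurableEmbedding
    (fun t ↦ ENNReal.ofReal (t ^ (-p) / 2)) (Set.Ioi 1)
  rw [← MeasurableEquiv.coe_addLeft, hpre] at hshift
  rw [hshift, ← ofReal_integral_eq_lintegral_ofReal, integral_div,
    integral_Ioi_rpow_of_lt (by linarith) one_pos]
  · congr 1
    rw [Real.one_rpow, show -p + 1 = -(p - 1) by ring, show 2 * p - 2 = (p - 1) * 2 by ring,
      neg_div_neg_eq, one_div, mul_inv, div_eq_mul_inv]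
  · exact (integrableOn_Ioi_rpow_of_lt (by linarith) one_pos).div_const 2
  · filter_upwards [ae_restrict_mem measurableSet_Ioi] with t ht
    have : (0 : ℝ) < t := one_pos.trans ht
    positivity

lemma map_inner_stdGaussian (a : E) :
    (stdGaussian E).map (fun x ↦ ⟪a, x⟫) = gaussianReal 0 (‖a‖₊ ^ 2) := by
  have h := IsGaussian.map_eq_gaussianReal (μ := stdGaussian E) (innerSL ℝ a)
  rw [variance_dual_stdGaussian, integral_strongDual_stdGaussian, innerSL_apply_norm] at h
  rwa [Real.toNNReal_pow (norm_nonneg a), norm_toNNReal] at h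

lemma lintegral_inner_sq_stdGaussian (a : E) :
    ∫⁻ x, ENNReal.ofReal (⟪a, x⟫ ^ 2) ∂stdGaussian E = ENNReal.ofReal (‖a‖ ^ 2) := by
  have hL : MemLp (innerSL ℝ a) 2 (stdGaussian E) :=
    (innerSL ℝ a).comp_memLp' IsGaussian.memLp_two_id
  have hvar := variance_dual_stdGaussian (innerSL ℝ a)
  rw [variance_of_integral_eq_zero (by fun_prop) (integral_strongDual_stdGaussian _),
    innerSL_apply_norm] at hvar
  rw [← hvar, ofReal_integral_eq_lintegral_ofReal hL.integrable_sq
    (.of_forall fun x ↦ sq_nonneg _)]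
  simp

/-- A proper subspace is orthogonal to some `a ≠ 0`, and `⟪a, x⟫` has a law without atoms. -/
lemma stdGaussian_ae_notMem {K : Submodule ℝ E} (hK : K ≠ ⊤) : ∀ᵐ x ∂stdGaussian E, x ∉ K := by
  obtain ⟨a, ha, ha0⟩ := K.orthogonal.ne_bot_iff.1 (by rwa [ne_eq, Submodule.orthogonal_eq_bot_iff])
  have hmap := map_inner_stdGaussian a
  have hno : NullSingletonClass (gaussianReal 0 (‖a‖₊ ^ 2)) :=
    nullSingletonClass_gaussianReal (by simpa using ha0)
  have : ∀ᵐ x ∂stdGaussian E, ⟪a, x⟫ ≠ 0 := by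
    have h0 : ∀ᵐ t ∂(stdGaussian E).map (fun x ↦ ⟪a, x⟫), t ≠ 0 := by
      rw [hmap]; exact Measure.ae_ne _ 0
    exact ae_of_ae_map (f := fun x ↦ ⟪a, x⟫) (by fun_prop) h0
  filter_upwards [this] with x hx hxK
  exact hx ((Submodule.mem_orthogonal' K a).1 ha x hxK)

/-- The negative second moment of a standard Gaussian vector. It follows from
`1 / a = ∫ s in (0, ∞), exp (-s a / 2) / 2`, Tonelli, and the Laplace transform of `‖x‖ ^ 2`. The
junk value of the integrand at `0` is irrelevant, since the origin is a null set. -/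
lemma lintegral_inv_normSq_stdGaussian (hE : 2 < Module.finrank ℝ E) :
    ∫⁻ x, ENNReal.ofReal ((‖x‖ ^ 2)⁻¹) ∂stdGaussian E
      = ENNReal.ofReal (((Module.finrank ℝ E : ℝ) - 2)⁻¹) := by
  have hE' : (2 : ℝ) < Module.finrank ℝ E := by exact_mod_cast hE
  have : Nontrivial E := Module.nontrivial_of_finrank_pos (R := ℝ) (by omega)
  have hne : ∀ᵐ x ∂stdGaussian E, x ≠ 0 := by
    simpa using stdGaussian_ae_notMem (bot_ne_top (α := Submodule ℝ E))
  calc ∫⁻ x, ENNReal.ofReal ((‖x‖ ^ 2)⁻¹) ∂stdGaussian E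
    _ = ∫⁻ x, (∫⁻ s in Set.Ioi (0 : ℝ), ENNReal.ofReal (Real.exp (-(s * ‖x‖ ^ 2 / 2)) / 2))
          ∂stdGaussian E := by
        refine lintegral_congr_ae ?_
        filter_upwards [hne] with x hx
        rw [lintegral_exp_neg_mul_Ioi (by positivity)]
    _ = ∫⁻ s in Set.Ioi (0 : ℝ), ∫⁻ x, ENNReal.ofReal (Real.exp (-(s * ‖x‖ ^ 2 / 2)) / 2)
          ∂stdGaussian E := by
        rw [lintegral_lintegral_swap]
        exact Measurable.aemeasurable (by fun_prop)
    _ = ∫⁻ s in Set.Ioi (0 : ℝ),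
          ENNReal.ofReal ((1 + s) ^ (-(Module.finrank ℝ E / 2) : ℝ) / 2) := by
        refine setLIntegral_congr_fun measurableSet_Ioi fun s hs ↦ ?_
        have hs : (0 : ℝ) < s := hs
        rw [← integral_exp_neg_mul_normSq_stdGaussian hs.le, ← integral_div,
          ofReal_integral_eq_lintegral_ofReal]
        · refine (Integrable.of_bound (C := 1) (Continuous.aestronglyMeasurable (by fun_prop))
            (.of_forall fun x ↦ ?_)).div_const 2
          rw [Real.norm_of_nonneg (by positivity), Real.exp_le_one_iff]
          have : 0 ≤ s * ‖x‖ ^ 2 / 2 := by positivity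
          linarith
        · exact .of_forall fun x ↦ by positivity
    _ = ENNReal.ofReal (((Module.finrank ℝ E : ℝ) - 2)⁻¹) := by
        rw [lintegral_one_add_rpow_Ioi (by linarith)]
        congr 2
        ring

lemma map_orthogonalProjectionOnto_stdGaussian (K : Submodule ℝ E) :
    (stdGaussian E).map K.orthogonalProjectionOnto = stdGaussian K := by
  have : IsProbabilityMeasure ((stdGaussian E).map K.orthogonalProjectionOnto) :=
    Measure.isProbabilityMeasure_map (by fun_prop)
  apply Measure.ext_of_charFun
  ext t
  rw [charFun_stdGaussian, charFun_apply, integral_map (by fun_prop)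
    (Continuous.aestronglyMeasurable (by fun_prop))]
  simp_rw [Submodule.coe_norm, ← charFun_stdGaussian, charFun_apply,
    Submodule.inner_orthogonalProjectionOnto_eq_of_mem_right]

end StdGaussian

/-! ### Inverse Gram matrices -/

section Gram

variable {E : Type*} [NormedAddCommGroup E] [InnerProductSpace ℝ E]

/-- A diagonal entry of the inverse Gram matrix is the reciprocal of the squared distance from the
corresponding vector to the span of the others. -/
lemma inv_gram_apply_self {d : ℕ} {G : Fin (d + 1) → E} (hG : LinearIndependent ℝ G)
    (j : Fin (d + 1)) (K : Submodule ℝ E) [K.HasOrthogonalProjection]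
    (hK : K = Submodule.span ℝ (Set.range fun i ↦ G (j.succAbove i))) :
    (Matrix.gram ℝ G)⁻¹ j j = (‖Kᗮ.orthogonalProjectionOnto (G j)‖ ^ 2)⁻¹ := by
  have hdet : IsUnit (Matrix.gram ℝ G).det :=
    (Matrix.det_gram_ne_zero_iff_linearIndependent.2 hG).isUnit
  set h : E := Kᗮ.starProjection (G j) with hh
  have hmem : K.starProjection (G j) ∈ Submodule.span ℝ (Set.range fun i ↦ G (j.succAbove i)) := by
    rw [← hK]
    exact K.starProjection_apply_mem _
  obtain ⟨c, hc⟩ := (Submodule.mem_span_range_iff_exists_fun ℝ).1 hmem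
  -- `v` lists the coefficients that express the residual `h` in the family `G`.
  let v : Fin (d + 1) → ℝ := j.insertNth 1 (-c)
  have hv : ∑ i, v i • G i = h := by
    rw [Fin.sum_univ_succAbove _ j, hh, Submodule.starProjection_orthogonal_val, ← hc]
    simp [v, sub_eq_add_neg]
  have hmul : Matrix.gram ℝ G *ᵥ v = Pi.single j (‖h‖ ^ 2) := by
    ext k
    have hk : (Matrix.gram ℝ G *ᵥ v) k = ⟪G k, h⟫ := by
      simp [Matrix.mulVec, dotProduct, Matrix.gram_apply, ← hv, inner_sum, inner_smul_right,
        mul_comm]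
    rw [hk]
    rcases Fin.eq_self_or_eq_succAbove j k with rfl | ⟨i, rfl⟩
    · rw [Pi.single_eq_same, ← real_inner_self_eq_norm_sq, hh,
        Kᗮ.inner_starProjection_left_eq_right (G k) (Kᗮ.starProjection (G k)),
        Submodule.starProjection_eq_self_iff.2 (Submodule.starProjection_apply_mem _ _)]
    · rw [Pi.single_eq_of_ne (Fin.succAbove_ne j i)]
      refine (K.mem_orthogonal h).1 (Submodule.starProjection_apply_mem _ _) _ ?_
      rw [hK]
      exact Submodule.subset_span ⟨i, rfl⟩
  have hone : (1 : ℝ) = (Matrix.gram ℝ G)⁻¹ j j * ‖h‖ ^ 2 := by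
    calc (1 : ℝ) = v j := by simp [v]
      _ = ((Matrix.gram ℝ G)⁻¹ *ᵥ (Matrix.gram ℝ G *ᵥ v)) j := by
          rw [Matrix.mulVec_mulVec, Matrix.nonsing_inv_mul _ hdet, Matrix.one_mulVec]
      _ = (Matrix.gram ℝ G)⁻¹ j j * ‖h‖ ^ 2 := by
          rw [hmul, Matrix.mulVec_single]; simp
  exact eq_inv_of_mul_eq_one_left hone.symm

/-- For a linearly independent family `G`, the left side is the `j`-th coordinate at `g` of the
pseudo-inverse of `c ↦ ∑ k, c k • G k`; the right side exhibits the `j`-th row of that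
pseudo-inverse as a vector. -/
lemma inv_gram_row_inner {ι : Type*} [Fintype ι] [DecidableEq ι] (G : ι → E) (g : E) (j : ι) :
    ((Matrix.gram ℝ G)⁻¹ *ᵥ fun k ↦ ⟪G k, g⟫) j = ⟪∑ k, (Matrix.gram ℝ G)⁻¹ j k • G k, g⟫ := by
  simp [Matrix.mulVec, dotProduct, sum_inner, inner_smul_left]

/-- The inner products of the rows of the pseudo-inverse are the entries of
`M⁻¹ * M * M⁻¹ = M⁻¹`, for `M` the Gram matrix. -/
lemma normSq_inv_gram_row {ι : Type*} [Fintype ι] [DecidableEq ι] {G : ι → E}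
    (hG : LinearIndependent ℝ G) (j : ι) :
    ‖∑ k, (Matrix.gram ℝ G)⁻¹ j k • G k‖ ^ 2 = (Matrix.gram ℝ G)⁻¹ j j := by
  have hdet : IsUnit (Matrix.gram ℝ G).det :=
    (Matrix.det_gram_ne_zero_iff_linearIndependent.2 hG).isUnit
  have hsymm : ((Matrix.gram ℝ G)⁻¹)ᵀ = (Matrix.gram ℝ G)⁻¹ := by
    rw [Matrix.transpose_nonsing_inv]
    congr 1
    ext i k
    simp [Matrix.gram_apply, real_inner_comm]
  rw [← real_inner_self_eq_norm_sq, ← inv_gram_row_inner]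
  have : (fun k ↦ ⟪G k, ∑ l, (Matrix.gram ℝ G)⁻¹ j l • G l⟫)
      = Matrix.gram ℝ G *ᵥ fun l ↦ (Matrix.gram ℝ G)⁻¹ l j := by
    ext k
    have hs (l : ι) : (Matrix.gram ℝ G)⁻¹ j l = (Matrix.gram ℝ G)⁻¹ l j :=
      (congrFun (congrFun hsymm l) j)
    simp [Matrix.mulVec, dotProduct, Matrix.gram_apply, inner_sum, inner_smul_right, hs, mul_comm]
  rw [this, Matrix.mulVec_mulVec, Matrix.nonsing_inv_mul _ hdet, Matrix.one_mulVec]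

lemma continuous_gram {ι : Type*} : Continuous fun G : ι → E ↦ Matrix.gram ℝ G :=
  continuous_matrix fun i j ↦ by simp only [Matrix.gram_apply]; fun_prop

lemma measurable_inv_gram_apply [FiniteDimensional ℝ E] [MeasurableSpace E] [BorelSpace E]
    {ι : Type*} [Fintype ι] [DecidableEq ι] (i j : ι) :
    Measurable fun G : ι → E ↦ (Matrix.gram ℝ G)⁻¹ i j := by
  have : ProperSpace E := FiniteDimensional.proper ℝ E
  simp only [Matrix.inv_def, Ring.inverse_eq_inv', Matrix.smul_apply, smul_eq_mul]
  exact (continuous_gram.matrix_det.measurable.inv).mul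
    ((continuous_gram.matrix_adjugate.matrix_elem i j).measurable)

lemma measurable_inv_gram_mulVec_apply [FiniteDimensional ℝ E] [MeasurableSpace E] [BorelSpace E]
    {ι : Type*} [Fintype ι] [DecidableEq ι] (j : ι) :
    Measurable fun p : E × (ι → E) ↦ ((Matrix.gram ℝ p.2)⁻¹ *ᵥ fun k ↦ ⟪p.2 k, p.1⟫) j := by
  simp only [Matrix.mulVec, dotProduct]
  refine Finset.measurable_sum _ fun k _ ↦ ?_
  exact ((measurable_inv_gram_apply j k).comp measurable_snd).mul (by fun_prop)

end Gram

/-! ### Gaussian families and the mean of the inverse Wishart matrix -/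

section Wishart

variable {E : Type*} [NormedAddCommGroup E] [InnerProductSpace ℝ E] [FiniteDimensional ℝ E]
  [MeasurableSpace E] [BorelSpace E]

/-- By induction on `d`: almost surely, a standard Gaussian vector lies outside the span of an
independent family of fewer than `finrank ℝ E` vectors. -/
lemma ae_linearIndependent_pi_stdGaussian {d : ℕ} (hd : d ≤ Module.finrank ℝ E) :
    ∀ᵐ G ∂Measure.pi (fun _ : Fin d ↦ stdGaussian E), LinearIndependent ℝ G := by
  induction d with
  | zero => exact .of_forall fun _ ↦ linearIndependent_empty_type
  | succ d ih =>
    have hmp := measurePreserving_piFinSuccAbove (fun _ : Fin (d + 1) ↦ stdGaussian E) 0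
    have hcont : Continuous fun p : E × (Fin d → E) ↦ (Fin.cons p.1 p.2 : Fin (d + 1) → E) := by
      fun_prop
    have hmeas : MeasurableSet {p : E × (Fin d → E) |
        LinearIndependent ℝ (Fin.cons p.1 p.2 : Fin (d + 1) → E)} := by
      -- Linear independence is an open condition: the Gram determinant does not vanish.
      simp_rw [← Matrix.det_gram_ne_zero_iff_linearIndependent]
      exact (isOpen_ne.preimage (continuous_gram.comp hcont).matrix_det).measurableSet
    have hae : ∀ᵐ p ∂(stdGaussian E).prod (Measure.pi fun _ : Fin d ↦ stdGaussian E),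
        LinearIndependent ℝ (Fin.cons p.1 p.2 : Fin (d + 1) → E) := by
      rw [Measure.ae_prod_iff_ae_ae hmeas, Measure.ae_ae_comm hmeas]
      filter_upwards [ih (by omega)] with H hH
      have hK : Submodule.span ℝ (Set.range H) ≠ ⊤ := by
        intro h
        have h1 := finrank_span_eq_card hH
        rw [h, finrank_top, Fintype.card_fin] at h1
        omega
      filter_upwards [stdGaussian_ae_notMem hK] with x hx
      exact linearIndependent_finCons.2 ⟨hH, hx⟩
    filter_upwards [hmp.quasiMeasurePreserving.ae hae] with G hG
    simpa [MeasurableEquiv.piFinSuccAbove, Fin.insertNthEquiv, Fin.cons_self_tail] using hG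

/-- The mean of a diagonal entry of an inverse Wishart matrix. Given the other vectors, the entry is
the reciprocal of `‖x‖ ^ 2` for a standard Gaussian vector `x` of the orthogonal complement of
their span. -/
lemma lintegral_inv_gram_apply_self {d : ℕ} (hd : d + 1 < Module.finrank ℝ E) (j : Fin d) :
    ∫⁻ G, ENNReal.ofReal ((Matrix.gram ℝ G)⁻¹ j j) ∂Measure.pi (fun _ : Fin d ↦ stdGaussian E)
      = ENNReal.ofReal (((Module.finrank ℝ E : ℝ) - d - 1)⁻¹) := by
  obtain _ | d := d
  · exact j.elim0
  have hmp := (measurePreserving_piFinSuccAbove (fun _ : Fin (d + 1) ↦ stdGaussian E) j).symm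
  have hmeas := (measurable_inv_gram_apply (E := E) j j).ennreal_ofReal
  refine (hmp.lintegral_comp hmeas).symm.trans
    ((lintegral_prod_symm' _ (hmeas.comp hmp.measurable)).trans ?_)
  have hinner : ∀ᵐ H ∂Measure.pi (fun _ : Fin d ↦ stdGaussian E),
      ∫⁻ x, ENNReal.ofReal ((Matrix.gram ℝ (j.insertNth x H))⁻¹ j j) ∂stdGaussian E
        = ENNReal.ofReal (((Module.finrank ℝ E : ℝ) - (d + 1 : ℕ) - 1)⁻¹) := by
    filter_upwards [ae_linearIndependent_pi_stdGaussian (E := E) (d := d) (by omega)] with H hH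
    set K := Submodule.span ℝ (Set.range H) with hKdef
    have hKfin : Module.finrank ℝ K = d := by simpa using finrank_span_eq_card hH
    have hsum := K.finrank_add_finrank_orthogonal
    have hK : K ≠ ⊤ := by
      intro h
      rw [h, finrank_top] at hKfin
      omega
    calc _ = ∫⁻ x, ENNReal.ofReal ((‖Kᗮ.orthogonalProjectionOnto x‖ ^ 2)⁻¹) ∂stdGaussian E := by
          refine lintegral_congr_ae ?_
          filter_upwards [stdGaussian_ae_notMem hK] with x hx
          have hli : LinearIndependent ℝ (j.insertNth x H : Fin (d + 1) → E) := by
            rw [← linearIndependent_equiv (finSuccEquiv' j).symm, linearIndependent_option]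
            exact ⟨by simpa [Function.comp_def] using hH,
              by simpa [hKdef, Function.comp_def] using hx⟩
          rw [inv_gram_apply_self hli j K (by simp [hKdef])]
          simp
      _ = ∫⁻ y, ENNReal.ofReal ((‖y‖ ^ 2)⁻¹) ∂stdGaussian Kᗮ := by
          rw [← map_orthogonalProjectionOnto_stdGaussian, lintegral_map (by fun_prop) (by fun_prop)]
      _ = _ := by
          rw [lintegral_inv_normSq_stdGaussian (by omega)]
          have : (Module.finrank ℝ E : ℝ) = d + Module.finrank ℝ Kᗮ := by
            rw [← hsum, hKfin]; push_cast; rfl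
          rw [this]
          push_cast
          congr 2
          ring
  exact (lintegral_congr_ae hinner).trans (by simp)

/-- The mean squared length of the least-squares coefficients of a Gaussian vector `g` regressed on
an independent Gaussian family `G`. Averaging over `g` first leaves the trace of the inverse Gram
matrix of `G`. -/
lemma lintegral_normSq_inv_gram_mulVec {d : ℕ} (hd : d + 1 < Module.finrank ℝ E) :
    ∫⁻ p : E × (Fin d → E), ENNReal.ofReal
        (∑ j, ((Matrix.gram ℝ p.2)⁻¹ *ᵥ fun k ↦ ⟪p.2 k, p.1⟫) j ^ 2)
        ∂(stdGaussian E).prod (Measure.pi fun _ ↦ stdGaussian E)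
      = ENNReal.ofReal (d / ((Module.finrank ℝ E : ℝ) - d - 1)) := by
  have hmeas (j : Fin d) : Measurable fun p : E × (Fin d → E) ↦
      ENNReal.ofReal (((Matrix.gram ℝ p.2)⁻¹ *ᵥ fun k ↦ ⟪p.2 k, p.1⟫) j ^ 2) :=
    ((measurable_inv_gram_mulVec_apply j).pow_const 2).ennreal_ofReal
  have hpos : (0 : ℝ) ≤ ((Module.finrank ℝ E : ℝ) - d - 1)⁻¹ := by
    have : (d + 1 : ℝ) < Module.finrank ℝ E := by exact_mod_cast hd
    exact inv_nonneg.2 (by linarith)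
  have hterm (j : Fin d) : ∫⁻ p : E × (Fin d → E), ENNReal.ofReal
        (((Matrix.gram ℝ p.2)⁻¹ *ᵥ fun k ↦ ⟪p.2 k, p.1⟫) j ^ 2)
        ∂(stdGaussian E).prod (Measure.pi fun _ ↦ stdGaussian E)
      = ENNReal.ofReal (((Module.finrank ℝ E : ℝ) - d - 1)⁻¹) := by
    rw [lintegral_prod_symm' _ (hmeas j), ← lintegral_inv_gram_apply_self hd j]
    refine lintegral_congr_ae ?_
    filter_upwards [ae_linearIndependent_pi_stdGaussian (E := E) (d := d) (by omega)] with G hG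
    simp only [inv_gram_row_inner]
    rw [lintegral_inner_sq_stdGaussian, normSq_inv_gram_row hG]
  simp_rw [ENNReal.ofReal_sum_of_nonneg fun j _ ↦ sq_nonneg _]
  rw [lintegral_finsetSum _ fun j _ ↦ hmeas j]
  simp_rw [hterm]
  rw [← ENNReal.ofReal_sum_of_nonneg fun j _ ↦ hpos]
  simp [div_eq_mul_inv]

lemma integral_normSq_inv_gram_mulVec {d : ℕ} (hd : d + 1 < Module.finrank ℝ E) :
    Integrable (fun p : E × (Fin d → E) ↦
        ∑ j, ((Matrix.gram ℝ p.2)⁻¹ *ᵥ fun k ↦ ⟪p.2 k, p.1⟫) j ^ 2)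
        ((stdGaussian E).prod (Measure.pi fun _ ↦ stdGaussian E)) ∧
      ∫ p : E × (Fin d → E), ∑ j, ((Matrix.gram ℝ p.2)⁻¹ *ᵥ fun k ↦ ⟪p.2 k, p.1⟫) j ^ 2
        ∂(stdGaussian E).prod (Measure.pi fun _ ↦ stdGaussian E)
      = d / ((Module.finrank ℝ E : ℝ) - d - 1) := by
  have hmeas : Measurable fun p : E × (Fin d → E) ↦
      ∑ j, ((Matrix.gram ℝ p.2)⁻¹ *ᵥ fun k ↦ ⟪p.2 k, p.1⟫) j ^ 2 :=
    Finset.measurable_sum _ fun j _ ↦ (measurable_inv_gram_mulVec_apply j).pow_const 2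
  have hnonneg : ∀ p : E × (Fin d → E),
      0 ≤ ∑ j, ((Matrix.gram ℝ p.2)⁻¹ *ᵥ fun k ↦ ⟪p.2 k, p.1⟫) j ^ 2 :=
    fun p ↦ Finset.sum_nonneg fun j _ ↦ sq_nonneg _
  have hlint := lintegral_normSq_inv_gram_mulVec hd
  have hpos : (0 : ℝ) ≤ d / ((Module.finrank ℝ E : ℝ) - d - 1) := by
    have : (d + 1 : ℝ) < Module.finrank ℝ E := by exact_mod_cast hd
    exact div_nonneg d.cast_nonneg (by linarith)
  refine ⟨(lintegral_ofReal_ne_top_iff_integrable hmeas.aestronglyMeasurable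
    (.of_forall hnonneg)).1 (hlint ▸ ENNReal.ofReal_ne_top), ?_⟩
  rw [integral_eq_lintegral_of_nonneg_ae (.of_forall hnonneg) hmeas.aestronglyMeasurable, hlint,
    ENNReal.toReal_ofReal hpos]

end Wishart

/-! ### The law of a Gaussian sketch on an orthonormal family -/

section Sketch

/-- An orthonormal family pushed through a Gaussian sketch, rescaled by `√m`, becomes a family of
independent standard Gaussian vectors. Both laws have the characteristic function
`t ↦ exp (-∑ i, ‖t i‖ ^ 2 / 2)`. -/
lemma IsGaussianSketch.hasLaw_orthonormal {Ω : Type*} [MeasurableSpace Ω] {P : Measure Ω}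
    [IsProbabilityMeasure P] {m n : ℕ} (hm : 0 < m) {S : Ω → Matrix (Fin m) (Fin n) ℝ}
    (hS : IsGaussianSketch P S) {ι : Type*} [Fintype ι] {u : ι → EuclideanSpace ℝ (Fin n)}
    (hu : Orthonormal ℝ u) :
    HasLaw (fun ω i ↦ √m • Matrix.toEuclideanLin (S ω) (u i))
      (Measure.pi fun _ : ι ↦ stdGaussian (EuclideanSpace ℝ (Fin m))) P := by
  classical
  have hmeas : AEMeasurable (fun ω (p : Fin m × Fin n) ↦ S ω p.1 p.2) P :=
    aemeasurable_pi_lambda _ fun p ↦ (hS.hasLaw p.1 p.2).aemeasurable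
  have hlaw : P.map (fun ω (p : Fin m × Fin n) ↦ S ω p.1 p.2)
      = Measure.pi fun _ ↦ gaussianReal 0 ((m : ℝ≥0)⁻¹) := by
    refine ((iIndepFun_iff_map_fun_eq_pi_map fun p : Fin m × Fin n ↦
      (hS.hasLaw p.1 p.2).aemeasurable).1 hS.indep).trans ?_
    congr 1
    ext1 p
    exact (hS.hasLaw p.1 p.2).map_eq
  -- The sketched family is the image of the array of entries under a continuous map.
  let T : (Fin m × Fin n → ℝ) → ι → EuclideanSpace ℝ (Fin m) := fun s i ↦
    √m • WithLp.toLp 2 fun a ↦ ∑ b, s (a, b) * u i b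
  have hT : Continuous T := by fun_prop
  have hTS : (fun ω i ↦ √m • Matrix.toEuclideanLin (S ω) (u i))
      = T ∘ fun ω (p : Fin m × Fin n) ↦ S ω p.1 p.2 := by
    ext ω i a
    simp [T, Matrix.mulVec, dotProduct, Matrix.toLpLin_apply]
  rw [hTS]
  refine ⟨hT.measurable.comp_aemeasurable hmeas, ?_⟩
  rw [← AEMeasurable.map_map_of_aemeasurable hT.measurable.aemeasurable hmeas, hlaw]
  refine (MeasurableEquiv.toLp 2 (ι → EuclideanSpace ℝ (Fin m))).map_measurableEquiv_injective ?_
  rw [MeasurableEquiv.coe_toLp]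
  have hprob : IsProbabilityMeasure ((Measure.pi fun _ : Fin m × Fin n ↦
      gaussianReal 0 ((m : ℝ≥0)⁻¹)).map T) := Measure.isProbabilityMeasure_map (by fun_prop)
  have : IsProbabilityMeasure (((Measure.pi fun _ : Fin m × Fin n ↦
      gaussianReal 0 ((m : ℝ≥0)⁻¹)).map T).map (WithLp.toLp 2)) :=
    Measure.isProbabilityMeasure_map (by fun_prop)
  have : IsProbabilityMeasure ((Measure.pi fun _ : ι ↦
      stdGaussian (EuclideanSpace ℝ (Fin m))).map (WithLp.toLp 2)) :=
    Measure.isProbabilityMeasure_map (by fun_prop)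
  refine Measure.ext_of_charFun (E := PiLp 2 fun _ : ι ↦ EuclideanSpace ℝ (Fin m)) ?_
  ext t
  rw [charFun_pi, charFun_apply, Measure.map_map (by fun_prop) hT.measurable,
    integral_map (by fun_prop) (Continuous.aestronglyMeasurable (by fun_prop))]
  let c : Fin m × Fin n → ℝ := fun p ↦ √m * ∑ i, t i p.1 * u i p.2
  have hinner (s : Fin m × Fin n → ℝ) : ⟪(WithLp.toLp 2 ∘ T) s, t⟫ = ∑ p, s p * c p := by
    simp only [PiLp.inner_apply, T, c, Function.comp_apply, Fintype.sum_prod_type,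
      PiLp.smul_apply, smul_eq_mul, Finset.mul_sum, RCLike.inner_apply, map_sum, Real.ringHom_apply]
    rw [Finset.sum_comm]
    refine Finset.sum_congr rfl fun a _ ↦ ?_
    rw [Finset.sum_comm]
    refine Finset.sum_congr rfl fun b _ ↦ Finset.sum_congr rfl fun i _ ↦ ?_
    ring
  -- For each row `a`, this is Parseval's identity for the orthonormal family `u`.
  have hc : ∑ p, c p ^ 2 = m * ∑ i, ‖t i‖ ^ 2 := by
    have hrow (a : Fin m) : ∑ b, (∑ i, t i a * u i b) ^ 2 = ∑ i, t i a ^ 2 := by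
      have h := hu.inner_sum (fun i ↦ t i a) (fun i ↦ t i a) Finset.univ
      rw [real_inner_self_eq_norm_sq, EuclideanSpace.real_norm_sq_eq] at h
      simpa [pow_two] using h
    simp only [c, mul_pow, Real.sq_sqrt (Nat.cast_nonneg m), Fintype.sum_prod_type,
      ← Finset.mul_sum, hrow, EuclideanSpace.real_norm_sq_eq]
    rw [Finset.sum_comm]
  have hprod (s : Fin m × Fin n → ℝ) : Complex.exp (⟪(WithLp.toLp 2 ∘ T) s, t⟫ * Complex.I)
      = ∏ p, Complex.exp (c p * s p * Complex.I) := by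
    rw [hinner, ← Complex.exp_sum]
    push_cast
    rw [Finset.sum_mul]
    simp only [mul_comm]
  simp_rw [hprod]
  rw [integral_fintype_prod_eq_prod (f := fun p (x : ℝ) ↦ Complex.exp (c p * x * Complex.I))]
  simp_rw [← charFun_apply_real, charFun_gaussianReal, charFun_stdGaussian, ← Complex.exp_sum]
  congr 1
  have hm' : (m : ℂ) ≠ 0 := by exact_mod_cast hm.ne'
  have hcC : ∑ p, (c p : ℂ) ^ 2 = m * ∑ i, (‖t i‖ : ℂ) ^ 2 := by exact_mod_cast hc
  rw [← Finset.sum_div, Finset.sum_neg_distrib, eq_comm, ← mul_right_inj' hm', neg_div, mul_neg,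
    ← mul_div_assoc, ← hcC]
  simp only [Complex.ofReal_zero, mul_zero, zero_mul, zero_sub, Finset.sum_neg_distrib,
    ← Finset.sum_div, NNReal.coe_inv, NNReal.coe_natCast, Complex.ofReal_inv,
    Complex.ofReal_natCast, ← Finset.mul_sum]
  field_simp

end Sketch

/-! ### Least-squares solutions and sketched normal equations -/

section LeastSquares

variable {n d : ℕ} {A : Matrix (Fin n) (Fin d) ℝ} {b : EuclideanSpace ℝ (Fin n)}
  {x : EuclideanSpace ℝ (Fin d)}

/-- The normal equations. For fixed `y`, the cost at `x + t • y` exceeds that at `x` by a quadratic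
polynomial in `t` without constant term; being nonnegative, it has no linear term either. -/
lemma IsLeastSquaresSolution.inner_eq_zero (hx : IsLeastSquaresSolution A b x)
    (y : EuclideanSpace ℝ (Fin d)) :
    ⟪Matrix.toEuclideanLin A x - b, Matrix.toEuclideanLin A y⟫ = 0 := by
  set r := Matrix.toEuclideanLin A x - b with hr
  set w := Matrix.toEuclideanLin A y
  have hquad (t : ℝ) : 0 ≤ ‖w‖ ^ 2 * (t * t) + 2 * ⟪r, w⟫ * t + 0 := by
    have h := hx (x + t • y)
    simp only [lsCost] at h
    rw [map_add, map_smul, add_sub_right_comm, ← hr, norm_add_sq_real, inner_smul_right,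
      norm_smul, mul_pow, Real.norm_eq_abs, sq_abs] at h
    linarith
  have h := discrim_le_zero hquad
  rw [discrim] at h
  nlinarith [sq_nonneg ⟪r, w⟫]

lemma IsLeastSquaresSolution.lsCost_eq_add (hx : IsLeastSquaresSolution A b x)
    (y : EuclideanSpace ℝ (Fin d)) :
    lsCost A b y = lsCost A b x + ‖Matrix.toEuclideanLin A (y - x)‖ ^ 2 := by
  have h : Matrix.toEuclideanLin A y - b
      = (Matrix.toEuclideanLin A x - b) + Matrix.toEuclideanLin A (y - x) := by
    rw [map_sub]; abel
  simp only [lsCost]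
  rw [h, norm_add_sq_real, hx.inner_eq_zero]
  ring

/-- The distance from a sketched least-squares solution `z` to a point `x`, measured through `A`. In
coordinates along an orthonormal basis `u` of the column space, `A (z - x)` solves the normal
equations of the sketched residual `b - A x` regressed on the sketched basis. The common factor `c`
does not affect the solution. -/
lemma normSq_sketched_error (x : EuclideanSpace ℝ (Fin d)) {m : ℕ}
    {S : Matrix (Fin m) (Fin n) ℝ} {z : EuclideanSpace ℝ (Fin d)}
    (hz : IsLeastSquaresSolution (S * A) (Matrix.toEuclideanLin S b) z)
    (u : OrthonormalBasis (Fin d) ℝ (LinearMap.range (Matrix.toEuclideanLin A))) (c : ℝ)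
    {G : Fin d → EuclideanSpace ℝ (Fin m)}
    (hGu : ∀ k, G k = c • Matrix.toEuclideanLin S (u k)) (hG : LinearIndependent ℝ G) :
    ‖Matrix.toEuclideanLin A (z - x)‖ ^ 2 = ∑ j, ((Matrix.gram ℝ G)⁻¹ *ᵥ fun k ↦
      ⟪G k, c • Matrix.toEuclideanLin S (b - Matrix.toEuclideanLin A x)⟫) j ^ 2 := by
  have hmulS (y : EuclideanSpace ℝ (Fin d)) : Matrix.toEuclideanLin (S * A) y
      = Matrix.toEuclideanLin S (Matrix.toEuclideanLin A y) := by
    simp [Matrix.toLpLin_apply]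
  let e : LinearMap.range (Matrix.toEuclideanLin A) := ⟨_, LinearMap.mem_range_self _ (z - x)⟩
  let y : Fin d → ℝ := u.repr e
  have hsum : Matrix.toEuclideanLin A (z - x) = ∑ i, y i • (u i : EuclideanSpace ℝ (Fin n)) := by
    have h := congrArg Subtype.val (u.sum_repr e)
    rw [Submodule.coe_sum] at h
    exact h.symm
  have hnormal : Matrix.gram ℝ G *ᵥ y = fun k ↦
      ⟪G k, c • Matrix.toEuclideanLin S (b - Matrix.toEuclideanLin A x)⟫ := by
    ext k
    obtain ⟨xk, hxk⟩ := (u k).2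
    have h0 := hz.inner_eq_zero xk
    have hleft : (Matrix.gram ℝ G *ᵥ y) k
        = ⟪G k, c • Matrix.toEuclideanLin S (Matrix.toEuclideanLin A (z - x))⟫ := by
      simp [Matrix.mulVec, dotProduct, Matrix.gram_apply, hsum, inner_sum, inner_smul_right,
        Finset.smul_sum, smul_comm c, ← hGu, mul_comm]
    rw [hleft, ← sub_eq_zero, ← inner_sub_right, ← smul_sub, ← map_sub, hGu, ← hxk]
    have hdiff : Matrix.toEuclideanLin A (z - x) - (b - Matrix.toEuclideanLin A x)
        = Matrix.toEuclideanLin A z - b := by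
      rw [map_sub]; abel
    rw [hdiff, map_sub, ← hmulS, ← hmulS, inner_smul_left, inner_smul_right, real_inner_comm, h0]
    simp
  have hdet : IsUnit (Matrix.gram ℝ G).det :=
    (Matrix.det_gram_ne_zero_iff_linearIndependent.2 hG).isUnit
  rw [← hnormal, Matrix.mulVec_mulVec, Matrix.nonsing_inv_mul _ hdet, Matrix.one_mulVec]
  have := u.repr.norm_map e
  rw [show ‖Matrix.toEuclideanLin A (z - x)‖ = ‖e‖ from rfl, ← this,
    EuclideanSpace.real_norm_sq_eq]

end LeastSquares

/-! ### The mean error of the sketched solution -/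

/-- The expected squared error is that of regressing a Gaussian vector on an independent Gaussian
family, scaled by the squared norm of the residual of `(A, b)`. -/
lemma integral_normSq_sketched_error {Ω : Type*} [MeasurableSpace Ω] (P : Measure Ω)
    [IsProbabilityMeasure P] (m n d : ℕ) (hm : d + 1 < m)
    (A : Matrix (Fin n) (Fin d) ℝ) (hA : A.rank = d) (b : EuclideanSpace ℝ (Fin n))
    (xstar : EuclideanSpace ℝ (Fin d)) (hxstar : IsLeastSquaresSolution A b xstar)
    (S : Ω → Matrix (Fin m) (Fin n) ℝ) (hS : IsGaussianSketch P S)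
    (xhat : Ω → EuclideanSpace ℝ (Fin d))
    (hxhat : ∀ᵐ ω ∂P,
      IsLeastSquaresSolution (S ω * A) (Matrix.toEuclideanLin (S ω) b) (xhat ω)) :
    Integrable (fun ω => ‖Matrix.toEuclideanLin A (xhat ω - xstar)‖ ^ 2) P ∧
    ∫ ω, ‖Matrix.toEuclideanLin A (xhat ω - xstar)‖ ^ 2 ∂P
      = lsCost A b xstar * ((d : ℝ) / ((m : ℝ) - (d : ℝ) - 1)) := by
  have hrank : Module.finrank ℝ (LinearMap.range (Matrix.toEuclideanLin A)) = d := by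
    refine Eq.trans ?_ hA
    rw [Matrix.rank_eq_finrank_range_toLin A (EuclideanSpace.basisFun (Fin n) ℝ).toBasis
      (EuclideanSpace.basisFun (Fin d) ℝ).toBasis, Matrix.toEuclideanLin_eq_toLin_orthonormal]
  let u : OrthonormalBasis (Fin d) ℝ (LinearMap.range (Matrix.toEuclideanLin A)) :=
    (stdOrthonormalBasis ℝ _).reindex (finCongr hrank)
  have hu : Orthonormal ℝ fun k ↦ (u k : EuclideanSpace ℝ (Fin n)) :=
    u.orthonormal.comp_linearIsometry (Submodule.subtypeₗᵢ _)
  set r := b - Matrix.toEuclideanLin A xstar with hr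
  have hcost : lsCost A b xstar = ‖r‖ ^ 2 := by rw [lsCost, hr, norm_sub_rev]
  let G : Ω → Fin d → EuclideanSpace ℝ (Fin m) := fun ω k ↦
    √m • Matrix.toEuclideanLin (S ω) (u k)
  have hlawG : HasLaw G (Measure.pi fun _ ↦ stdGaussian (EuclideanSpace ℝ (Fin m))) P :=
    hS.hasLaw_orthonormal (by omega) hu
  have hli : ∀ᵐ ω ∂P, LinearIndependent ℝ (G ω) := by
    refine ae_of_ae_map (p := fun g ↦ LinearIndependent ℝ g) hlawG.aemeasurable ?_
    rw [hlawG.map_eq]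
    exact ae_linearIndependent_pi_stdGaussian (by rw [finrank_euclideanSpace_fin]; omega)
  have herr : ∀ᵐ ω ∂P, ‖Matrix.toEuclideanLin A (xhat ω - xstar)‖ ^ 2
      = ∑ j, ((Matrix.gram ℝ (G ω))⁻¹ *ᵥ fun k ↦
        ⟪G ω k, √m • Matrix.toEuclideanLin (S ω) r⟫) j ^ 2 := by
    filter_upwards [hxhat, hli] with ω hω hliω
    exact normSq_sketched_error xstar hω u √m (fun k ↦ rfl) hliω
  -- A zero residual cannot be normalized and may leave no room for a unit vector orthogonal to
  -- the column space; the error then vanishes almost surely.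
  rcases eq_or_ne r 0 with hr0 | hr0
  · have herr0 : (fun ω ↦ ‖Matrix.toEuclideanLin A (xhat ω - xstar)‖ ^ 2) =ᵐ[P] 0 := by
      filter_upwards [herr] with ω hω
      rw [hω, hr0]
      simp [Matrix.mulVec, dotProduct]
    rw [hcost, hr0, integral_congr_ae herr0]
    exact ⟨(integrable_zero _ _ _).congr herr0.symm, by simp⟩
  · have hu' : Orthonormal ℝ (Fin.cons (‖r‖⁻¹ • r) fun k ↦ (u k : EuclideanSpace ℝ (Fin n)) :
        Fin (d + 1) → EuclideanSpace ℝ (Fin n)) := by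
      refine orthonormal_vecCons_iff.2 ⟨?_, fun k ↦ ?_, hu⟩
      · simp [norm_smul, hr0]
      · obtain ⟨xk, hxk⟩ := (u k).2
        rw [← hxk, inner_smul_left, hr, ← neg_sub, inner_neg_left, hxstar.inner_eq_zero, neg_zero,
          mul_zero]
    have hpair := (measurePreserving_piFinSuccAbove
      (fun _ : Fin (d + 1) ↦ stdGaussian (EuclideanSpace ℝ (Fin m))) 0).hasLaw.comp
      (hS.hasLaw_orthonormal (by omega) hu')
    let V : Ω → EuclideanSpace ℝ (Fin m) × (Fin d → EuclideanSpace ℝ (Fin m)) := fun ω ↦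
      (√m • Matrix.toEuclideanLin (S ω) (‖r‖⁻¹ • r), G ω)
    have hV : HasLaw V ((stdGaussian (EuclideanSpace ℝ (Fin m))).prod
        (Measure.pi fun _ ↦ stdGaussian (EuclideanSpace ℝ (Fin m)))) P := hpair
    obtain ⟨hint, hval⟩ := integral_normSq_inv_gram_mulVec (E := EuclideanSpace ℝ (Fin m))
      (d := d) (by rw [finrank_euclideanSpace_fin]; omega)
    rw [← hV.map_eq] at hint hval
    rw [integral_map hV.aemeasurable hint.aestronglyMeasurable, finrank_euclideanSpace_fin] at hval
    replace hint := hint.comp_aemeasurable hV.aemeasurable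
    have herr' : (fun ω ↦ ‖Matrix.toEuclideanLin A (xhat ω - xstar)‖ ^ 2) =ᵐ[P] fun ω ↦ ‖r‖ ^ 2 *
        ∑ j, ((Matrix.gram ℝ (V ω).2)⁻¹ *ᵥ fun k ↦ ⟪(V ω).2 k, (V ω).1⟫) j ^ 2 := by
      filter_upwards [herr] with ω hω
      have hscale : (fun k ↦ ⟪G ω k, √m • Matrix.toEuclideanLin (S ω) r⟫)
          = ‖r‖ • fun k ↦ ⟪(V ω).2 k, (V ω).1⟫ := by
        ext k
        have : ‖r‖ ≠ 0 := norm_ne_zero_iff.2 hr0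
        simp only [V, map_smul, inner_smul_right, Pi.smul_apply, smul_eq_mul]
        field_simp
      rw [hω, hscale, Matrix.mulVec_smul, Finset.mul_sum]
      simp only [Pi.smul_apply, smul_eq_mul, mul_pow, V]
    rw [integral_congr_ae herr', integral_const_mul, hval, hcost]
    exact ⟨(hint.const_mul (‖r‖ ^ 2)).congr herr'.symm, rfl⟩

theorem mainTheorem2 {Ω : Type*} [MeasurableSpace Ω] (P : Measure Ω) [IsProbabilityMeasure P]
    (m n d : ℕ) (hm : d + 1 < m)
    (A : Matrix (Fin n) (Fin d) ℝ) (hA : A.rank = d) (b : EuclideanSpace ℝ (Fin n))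
    (xstar : EuclideanSpace ℝ (Fin d)) (hxstar : IsLeastSquaresSolution A b xstar)
    (S : Ω → Matrix (Fin m) (Fin n) ℝ) (hS : IsGaussianSketch P S)
    (xhat : Ω → EuclideanSpace ℝ (Fin d))
    (hxhat : ∀ᵐ ω ∂P,
      IsLeastSquaresSolution (S ω * A) (Matrix.toEuclideanLin (S ω) b) (xhat ω)) :
    Integrable (fun ω => ‖Matrix.toEuclideanLin A (xhat ω - xstar)‖ ^ 2) P ∧
    Integrable (fun ω => lsCost A b (xhat ω)) P ∧
    ∫ ω, ‖Matrix.toEuclideanLin A (xhat ω - xstar)‖ ^ 2 ∂P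
      = (∫ ω, lsCost A b (xhat ω) ∂P) - lsCost A b xstar ∧
    (∫ ω, lsCost A b (xhat ω) ∂P) - lsCost A b xstar
      = lsCost A b xstar * ((d : ℝ) / ((m : ℝ) - (d : ℝ) - 1)) := by
  obtain ⟨hint, hval⟩ :=
    integral_normSq_sketched_error P m n d hm A hA b xstar hxstar S hS xhat hxhat
  have hexcess : ∫ ω, lsCost A b (xhat ω) ∂P
      = lsCost A b xstar + ∫ ω, ‖Matrix.toEuclideanLin A (xhat ω - xstar)‖ ^ 2 ∂P := by
    simp_rw [hxstar.lsCost_eq_add (xhat _)]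
    rw [integral_add (integrable_const _) hint]
    simp
  refine ⟨hint, ?_, by rw [hexcess]; ring, by rw [hexcess, hval]; ring⟩
  simp_rw [hxstar.lsCost_eq_add (xhat _)]
  exact (integrable_const _).add hint
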